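/- Let $K$ be an algebraically closed field (of any characteristic) and let $H$ be a (not necessarily connected) linear algebraic group over $K$, i.e. an affine variety over $K$ (not necessarily irreducible, identified with its set of $K$-points) with a group structure whose multiplication and inversion are morphisms of varieties. The following are equivalent. \begin{enumerate} \item For every $n\ge 1$, every representation $\rho\colon H\to GL(n,K)$ (homomorphism of algebraic groups) has an $H$-eigenvector, i.e. there is a nonzero $v\in K^n$ such that for every $h\in H$ the vector $\rho(h)v$ is a scalar multiple of $v$. \item There is a (not necessarily connected) Zariski closed normal subgroup $U<H$ which is unipotent (all of its elements are unipotent) such that $H/U$ is abelian. \end{enumerate} Here $h\in H$ is unipotent if the operator $f\mapsto(x\mapsto f(xh))$ on the ring $K[H]$ of regular functions is locally unipotent, i.e. for every $f\in K[H]$ some power of (this operator minus the identity) annihilates $f$. -/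

import Mathlib

open scoped MatrixGroups

/-- Evaluation at a point `x`, as a `K`-algebra homomorphism on an algebra `A` of `K`-valued
functions on `X`. -/
def evalPoint {K X : Type*} [Field K] (A : Subalgebra K (X → K)) (x : X) : A →ₐ[K] K :=
  (Pi.evalAlgHom K (fun _ : X => K) x).comp A.val

/-- A linear (that is, affine) algebraic group over an algebraically closed field `K`, given by its
group `H` of `K`-points and its algebra `K[H]` of regular functions: `K[H]` is a finitely generated
algebra of functions whose `K`-algebra homomorphisms to `K` are exactly the evaluations at the
points of `H` (so `H` is an affine variety with coordinate ring `K[H]`), and multiplication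
`H × H → H` and inversion `H → H` are morphisms of varieties.  A regular function on `H × H` is
a finite sum of products `a x * b y` with `a`, `b` in `K[H]`. -/
class LinearAlgebraicGroup (K : Type*) [Field K] (H : Type*) [Group H] where
  /-- The algebra `K[H]` of regular functions. -/
  regularFunctions : Subalgebra K (H → K)
  fg : regularFunctions.FG
  bijective_evalPoint : Function.Bijective (evalPoint regularFunctions)
  regular_mul : ∀ f ∈ regularFunctions, ∃ (m : ℕ) (a b : Fin m → H → K),
    (∀ i, a i ∈ regularFunctions) ∧ (∀ i, b i ∈ regularFunctions) ∧
      ∀ x y : H, f (x * y) = ∑ i, a i x * b i y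
  regular_inv : ∀ f ∈ regularFunctions, (fun x : H => f x⁻¹) ∈ regularFunctions

namespace LinearAlgebraicGroup

section GeneralLinear

variable (K : Type*) [Field K] (n : ℕ)

/-- The functions on `GL(n,K)` that generate its coordinate ring: the matrix entries and the
inverse of the determinant. -/
def glGenerators : Set (GL (Fin n) K → K) :=
  {f | ∃ i j, f = fun g : GL (Fin n) K => (g : Matrix (Fin n) (Fin n) K) i j} ∪
    {fun g : GL (Fin n) K => (g : Matrix (Fin n) (Fin n) K).det⁻¹}

/-- The coordinate ring of `GL(n,K)`, `K[x₁₁, …, xₙₙ, det⁻¹]`. -/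
def glRegular : Subalgebra K (GL (Fin n) K → K) := Algebra.adjoin K (glGenerators K n)

variable {K n}

theorem entry_mem_glRegular (i j : Fin n) :
    (fun g : GL (Fin n) K => (g : Matrix (Fin n) (Fin n) K) i j) ∈ glRegular K n :=
  Algebra.subset_adjoin (Or.inl ⟨i, j, rfl⟩)

theorem detInv_mem_glRegular :
    (fun g : GL (Fin n) K => (g : Matrix (Fin n) (Fin n) K).det⁻¹) ∈ glRegular K n :=
  Algebra.subset_adjoin (Or.inr rfl)

theorem det_mem_glRegular (k : ℕ) (M : Matrix (Fin k) (Fin k) (GL (Fin n) K → K))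
    (hM : ∀ i j, M i j ∈ glRegular K n) : M.det ∈ glRegular K n := by
  rw [Matrix.det_apply]
  refine Subalgebra.sum_mem _ fun σ _ => ?_
  rw [Units.smul_def]
  exact Subalgebra.zsmul_mem _ (Subalgebra.prod_mem _ fun i _ => hM _ _) _

theorem glRegular_fg : (glRegular K n).FG := by
  refine Subalgebra.fg_def.2 ⟨glGenerators K n, ?_, rfl⟩
  refine Set.Finite.union ?_ (Set.finite_singleton _)
  refine (Set.finite_range (fun p : Fin n × Fin n =>
    fun g : GL (Fin n) K => (g : Matrix (Fin n) (Fin n) K) p.1 p.2)).subset ?_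
  rintro f ⟨i, j, rfl⟩
  exact ⟨(i, j), rfl⟩

theorem glRegular_bijective : Function.Bijective (evalPoint (glRegular K n)) := by
  constructor
  · intro g h hgh
    ext i j
    exact DFunLike.congr_fun hgh ⟨_, entry_mem_glRegular i j⟩
  · intro φ
    let X : Matrix (Fin n) (Fin n) (glRegular K n) := fun i j => ⟨_, entry_mem_glRegular i j⟩
    let d : glRegular K n := ⟨_, detInv_mem_glRegular⟩
    have hX : X.det * d = 1 := by
      apply Subtype.ext
      funext g
      have h1 : evalPoint (glRegular K n) g X.det =
          (g : Matrix (Fin n) (Fin n) K).det := by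
        rw [AlgHom.map_det]; rfl
      have h2 : (g : Matrix (Fin n) (Fin n) K).det ≠ 0 :=
        ((Matrix.isUnit_iff_isUnit_det _).1 g.isUnit).ne_zero
      change evalPoint (glRegular K n) g X.det * (g : Matrix (Fin n) (Fin n) K).det⁻¹ = 1
      rw [h1, mul_inv_cancel₀ h2]
    let M : Matrix (Fin n) (Fin n) K := φ.mapMatrix X
    have hM : M.det * φ d = 1 := by
      rw [← AlgHom.map_det, ← map_mul, hX, map_one]
    have hM0 : M.det ≠ 0 := left_ne_zero_of_mul_eq_one hM
    let g : GL (Fin n) K := Matrix.GeneralLinearGroup.mkOfDetNeZero M hM0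
    refine ⟨g, ?_⟩
    refine AlgHom.ext fun f => ?_
    obtain ⟨f, hf⟩ := f
    induction hf using Algebra.adjoin_induction with
    | mem f hf =>
      rcases hf with ⟨i, j, rfl⟩ | rfl
      · rfl
      · exact inv_eq_of_mul_eq_one_right hM
    | algebraMap r =>
      exact ((evalPoint (glRegular K n) g).commutes r).trans (φ.commutes r).symm
    | add f f' hf hf' h h' =>
      exact (map_add (evalPoint (glRegular K n) g) ⟨f, hf⟩ ⟨f', hf'⟩).trans
        ((congrArg₂ (· + ·) h h').trans (map_add φ ⟨f, hf⟩ ⟨f', hf'⟩).symm)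
    | mul f f' hf hf' h h' =>
      exact (map_mul (evalPoint (glRegular K n) g) ⟨f, hf⟩ ⟨f', hf'⟩).trans
        ((congrArg₂ (· * ·) h h').trans (map_mul φ ⟨f, hf⟩ ⟨f', hf'⟩).symm)

theorem glRegular_mul (f : GL (Fin n) K → K) (hf : f ∈ glRegular K n) :
    ∃ (m : ℕ) (a b : Fin m → GL (Fin n) K → K),
      (∀ i, a i ∈ glRegular K n) ∧ (∀ i, b i ∈ glRegular K n) ∧
        ∀ x y, f (x * y) = ∑ i, a i x * b i y := by
  -- it is convenient to allow an arbitrary finite index type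
  suffices h : ∃ (ι : Type) (_ : Fintype ι) (a b : ι → GL (Fin n) K → K),
      (∀ i, a i ∈ glRegular K n) ∧ (∀ i, b i ∈ glRegular K n) ∧
        ∀ x y, f (x * y) = ∑ i, a i x * b i y by
    obtain ⟨ι, _, a, b, ha, hb, hab⟩ := h
    let e := (Fintype.equivFin ι).symm
    refine ⟨Fintype.card ι, fun i => a (e i), fun i => b (e i), fun i => ha _, fun i => hb _, ?_⟩
    intro x y
    rw [hab, ← e.sum_comp]
  induction hf using Algebra.adjoin_induction with
  | mem f hf =>
    rcases hf with ⟨i, j, rfl⟩ | rfl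
    · exact ⟨Fin n, inferInstance, fun k g => (g : Matrix (Fin n) (Fin n) K) i k,
        fun k g => (g : Matrix (Fin n) (Fin n) K) k j, fun k => entry_mem_glRegular i k,
        fun k => entry_mem_glRegular k j, fun x y => by simp [Matrix.mul_apply]⟩
    · exact ⟨Unit, inferInstance, fun _ g => (g : Matrix (Fin n) (Fin n) K).det⁻¹,
        fun _ g => (g : Matrix (Fin n) (Fin n) K).det⁻¹, fun _ => detInv_mem_glRegular,
        fun _ => detInv_mem_glRegular, fun x y => by simp [mul_comm]⟩
  | algebraMap r =>
    exact ⟨Unit, inferInstance, fun _ => algebraMap K _ r, fun _ => 1,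
      fun _ => Subalgebra.algebraMap_mem _ r, fun _ => Subalgebra.one_mem _,
      fun x y => by simp⟩
  | add f f' _ _ h h' =>
    obtain ⟨ι, _, a, b, ha, hb, hab⟩ := h
    obtain ⟨ι', _, a', b', ha', hb', hab'⟩ := h'
    refine ⟨ι ⊕ ι', inferInstance, Sum.elim a a', Sum.elim b b', ?_, ?_, ?_⟩
    · rintro (i | i)
      exacts [ha i, ha' i]
    · rintro (i | i)
      exacts [hb i, hb' i]
    · intro x y
      simp [hab, hab']
  | mul f f' _ _ h h' =>
    obtain ⟨ι, _, a, b, ha, hb, hab⟩ := h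
    obtain ⟨ι', _, a', b', ha', hb', hab'⟩ := h'
    refine ⟨ι × ι', inferInstance, fun p => a p.1 * a' p.2, fun p => b p.1 * b' p.2,
      fun p => Subalgebra.mul_mem _ (ha _) (ha' _), fun p => Subalgebra.mul_mem _ (hb _) (hb' _),
      ?_⟩
    intro x y
    simp only [Pi.mul_apply, hab, hab', Finset.sum_mul_sum, Fintype.sum_prod_type]
    exact Finset.sum_congr rfl fun i _ => Finset.sum_congr rfl fun j _ => by ring

theorem glRegular_inv (f : GL (Fin n) K → K) (hf : f ∈ glRegular K n) :
    (fun g => f g⁻¹) ∈ glRegular K n := by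
  induction hf using Algebra.adjoin_induction with
  | mem f hf =>
    rcases hf with ⟨i, j, rfl⟩ | rfl
    · let Y : Matrix (Fin n) (Fin n) (GL (Fin n) K → K) :=
        fun i j g => (g : Matrix (Fin n) (Fin n) K) i j
      have hY : Y.adjugate i j ∈ glRegular K n := by
        rw [Matrix.adjugate_apply]
        refine det_mem_glRegular n _ fun k l => ?_
        rw [Matrix.updateRow_apply]
        split_ifs
        · rw [Pi.single_apply]
          split_ifs
          exacts [Subalgebra.one_mem _, Subalgebra.zero_mem _]
        · exact entry_mem_glRegular k l
      convert Subalgebra.mul_mem _ detInv_mem_glRegular hY using 1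
      funext g
      have h1 : Y.adjugate i j g = (g : Matrix (Fin n) (Fin n) K).adjugate i j := by
        have := RingHom.map_adjugate (Pi.evalRingHom (fun _ : GL (Fin n) K => K) g) Y
        exact congrFun (congrFun this i) j
      rw [Pi.mul_apply, h1]
      change ((g⁻¹ : GL (Fin n) K) : Matrix (Fin n) (Fin n) K) i j = _
      rw [Matrix.coe_units_inv, Matrix.inv_def, Ring.inverse_eq_inv']
      rfl
    · convert det_mem_glRegular n
        (fun i j (g : GL (Fin n) K) => (g : Matrix (Fin n) (Fin n) K) i j)
        entry_mem_glRegular using 1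
      funext g
      have := RingHom.map_det (Pi.evalRingHom (fun _ : GL (Fin n) K => K) g)
        (fun i j (g : GL (Fin n) K) => (g : Matrix (Fin n) (Fin n) K) i j)
      refine Eq.trans ?_ this.symm
      change ((g⁻¹ : GL (Fin n) K) : Matrix (Fin n) (Fin n) K).det⁻¹ = _
      rw [Matrix.coe_units_inv, Matrix.det_nonsing_inv, Ring.inverse_eq_inv', inv_inv]
      rfl
  | algebraMap r => exact Subalgebra.algebraMap_mem _ r
  | add f f' _ _ h h' => exact Subalgebra.add_mem _ h h'
  | mul f f' _ _ h h' => exact Subalgebra.mul_mem _ h h'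

/-- `GL(n,K)` as a linear algebraic group. -/
instance instGL : LinearAlgebraicGroup K (GL (Fin n) K) where
  regularFunctions := glRegular K n
  fg := glRegular_fg
  bijective_evalPoint := glRegular_bijective
  regular_mul := glRegular_mul
  regular_inv := glRegular_inv

end GeneralLinear

section Notions

variable (K : Type*) [Field K] {H : Type*} [Group H] [LinearAlgebraicGroup K H]

/-- A group homomorphism `φ : H → G` is a homomorphism of linear algebraic groups if it is a
morphism of varieties, that is, if it pulls regular functions back to regular functions. -/
def IsAlgebraicHom {G : Type*} [Group G] [LinearAlgebraicGroup K G] (φ : H →* G) : Prop :=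
  ∀ f ∈ regularFunctions (K := K) (H := G), f ∘ φ ∈ regularFunctions (K := K) (H := H)

/-- A subset of `H` is Zariski closed if it is the set of common zeros of a set of regular
functions. -/
def IsZariskiClosed (S : Set H) : Prop :=
  ∃ I : Set (H → K), I ⊆ regularFunctions (K := K) (H := H) ∧ S = {x | ∀ f ∈ I, f x = 0}

/-- Right translation by `h` on functions on `H`: `f ↦ (x ↦ f (x * h))`. -/
def rightTranslation (h : H) : (H → K) →ₗ[K] (H → K) :=
  LinearMap.funLeft K K (fun x => x * h)

/-- An element `h` of `H` is unipotent if right translation by `h` is a (locally) unipotent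
operator on `K[H]`: every regular function is killed by a power of (translation - identity). -/
def IsUnipotentElement (h : H) : Prop :=
  ∀ f ∈ regularFunctions (K := K) (H := H), ∃ m : ℕ, ((rightTranslation K h - 1) ^ m) f = 0

/-- A subgroup is unipotent if all its elements are unipotent. -/
def IsUnipotentSubgroup (U : Subgroup H) : Prop :=
  ∀ u ∈ U, IsUnipotentElement K u

variable {K}

/-- A nonzero vector `v ∈ Kⁿ` is an `H`-eigenvector of `ρ : H → GL(n,K)` if each `ρ h` maps it to a
multiple of itself. -/
def IsEigenvector {n : ℕ} (ρ : H →* GL (Fin n) K) (v : Fin n → K) : Prop :=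
  v ≠ 0 ∧ ∀ h : H, ∃ c : K, (ρ h : Matrix (Fin n) (Fin n) K).mulVec v = c • v

end Notions

end LinearAlgebraicGroup

/-! From (2) to (1): an algebraic homomorphism sends unipotent elements to unipotent matrices, so by
Kolchin's theorem `U` has nonzero fixed vectors. Normality makes the space of `U`-fixed vectors
stable under `H`. There `H` acts through the abelian group `H/U`, and commuting operators over an
algebraically closed field share an eigenvector.

From (1) to (2): take `U` to be the common kernel of all regular characters of `H`. It is closed and
normal with abelian quotient, whatever `H` is. By (1), a finite-dimensional rational representation
has an invariant line on which `H` acts by a regular character, trivial on `U`. Induction on the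
quotient by this line shows that `U` acts unipotently. Each regular function lies in such a
representation inside the right regular one (`exists_finiteDimensional_rational`), so the elements
of `U` are unipotent. -/

namespace Representation

/-! ### Common eigenvectors for unipotent and commuting groups of operators -/

variable {K G V : Type*} [Field K] [Group G] [AddCommGroup V] [Module K V]

/-- Burnside's theorem: over an algebraically closed field, an algebra of operators on a finite-dimensional
space without proper nonzero invariant subspaces consists of all operators. -/
theorem _root_.Subalgebra.eq_top_of_irreducible [IsAlgClosed K] [FiniteDimensional K V]
    [Nontrivial V] (A : Subalgebra K (Module.End K V))
    (hA : ∀ W : Submodule K V, (∀ a ∈ A, ∀ w ∈ W, a w ∈ W) → W = ⊥ ∨ W = ⊤) : A = ⊤ := by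
  have simple : IsSimpleModule A V := by
    rw [isSimpleModule_iff]
    refine { eq_bot_or_eq_top := fun W => ?_ }
    rcases hA (W.restrictScalars K) fun a ha w hw => W.smul_mem (⟨a, ha⟩ : A) hw with h | h
    · exact Or.inl (by simpa using h)
    · exact Or.inr (by simpa using h)
  refine eq_top_iff.2 fun f _ => ?_
  -- By Schur's lemma the commutant of `A` is `K`, so any `K`-linear `f` commutes with it. Density
  -- then matches `f` with an element of `A` on a basis.
  have scalar := (IsSimpleModule.algebraMap_end_bijective_of_isAlgClosed (A := A) (V := V) K).2
  let F : Module.End (Module.End A V) V :=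
    { toFun := f
      map_add' := f.map_add
      map_smul' := fun e v => by
        obtain ⟨c, rfl⟩ := scalar e
        exact f.map_smul c v }
  let b := Module.finBasis K V
  classical
  obtain ⟨r, hr⟩ := jacobson_density F (Finset.univ.image b)
  have : f = r := b.ext fun i => hr (b i) (Finset.mem_image_of_mem _ (Finset.mem_univ i))
  exact this ▸ r.2

/-- An irreducible group of unipotent operators is trivial. -/
theorem eq_one_of_irreducible_of_isNilpotent [IsAlgClosed K] [FiniteDimensional K V]
    [Nontrivial V] (ρ : Representation K G V) (hρ : ∀ g, IsNilpotent (ρ g - 1))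
    (irr : ∀ W : Submodule K V, (∀ g, ∀ w ∈ W, ρ g w ∈ W) → W = ⊥ ∨ W = ⊤) (g : G) :
    ρ g = 1 := by
  have htop : Algebra.adjoin K (Set.range ρ) = ⊤ :=
    Subalgebra.eq_top_of_irreducible _ fun W hW =>
      irr W fun h w hw => hW _ (Algebra.subset_adjoin ⟨h, rfl⟩) w hw
  -- The image of `ρ` is closed under products, so the algebra it generates is its linear span.
  have hspan : Submodule.span K (Set.range ρ) = ⊤ := by
    have := Algebra.adjoin_eq_span K (Set.range ρ)
    rw [htop, show Set.range ρ = (MonoidHom.mrange ρ : Set (Module.End K V)) from rfl,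
      Submonoid.closure_eq] at this
    exact this.symm
  have htr : ∀ h, LinearMap.trace K V (ρ h) = LinearMap.trace K V 1 := fun h => by
    have := (LinearMap.isNilpotent_trace_of_isNilpotent (hρ h)).eq_zero
    rwa [map_sub, sub_eq_zero] at this
  -- All `ρ h` have the same trace, so `(ρ g - 1) * ρ h = ρ (g * h) - ρ h` has trace zero; linearity
  -- extends this to every operator.
  have key : ∀ a : Module.End K V, LinearMap.trace K V ((ρ g - 1) * a) = 0 := fun a => by
    have ha : a ∈ Submodule.span K (Set.range ρ) := hspan ▸ Submodule.mem_top
    induction ha using Submodule.span_induction with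
    | mem a ha =>
      obtain ⟨h, rfl⟩ := ha
      rw [sub_mul, one_mul, ← map_mul, map_sub, htr, htr, sub_self]
    | zero => simp
    | add a b _ _ ha hb => rw [mul_add, map_add, ha, hb, add_zero]
    | smul c a _ ha => rw [mul_smul_comm, map_smul, ha, smul_zero]
  refine sub_eq_zero.1 (LinearMap.ext fun x => ?_)
  -- The trace form is nondegenerate: rank-one operators `a` already detect `ρ g - 1`.
  refine (Module.forall_dual_apply_eq_zero_iff K _).1 fun f => ?_
  have h1 : (ρ g - 1) * f.smulRight x = f.smulRight ((ρ g - 1) x) := by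
    ext y
    simp
  rw [← LinearMap.trace_smulRight, ← h1, key]

/-- Kolchin's theorem: a group of unipotent operators has a nonzero fixed vector. -/
theorem exists_fixed_of_isNilpotent [IsAlgClosed K] [FiniteDimensional K V]
    [Nontrivial V] (ρ : Representation K G V) (hρ : ∀ g, IsNilpotent (ρ g - 1)) :
    ∃ v : V, v ≠ 0 ∧ ∀ g, ρ g v = v := by
  induction hd : Module.finrank K V using Nat.strong_induction_on generalizing V with
  | _ d ih =>
  by_cases irr : ∀ W : Submodule K V, (∀ g, ∀ w ∈ W, ρ g w ∈ W) → W = ⊥ ∨ W = ⊤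
  · obtain ⟨v, hv⟩ := exists_ne (0 : V)
    exact ⟨v, hv, fun g => by
      rw [eq_one_of_irreducible_of_isNilpotent ρ hρ irr, Module.End.one_apply]⟩
  · push Not at irr
    obtain ⟨W, hW, hbot, htop⟩ := irr
    have : Nontrivial W := Submodule.nontrivial_iff_ne_bot.2 hbot
    obtain ⟨v, hv, hfix⟩ := ih _ (hd ▸ Submodule.finrank_lt htop) (ρ.subrepresentation W hW)
      (fun g => by
        obtain ⟨m, hm⟩ := hρ g
        refine ⟨m, LinearMap.ext fun w => Subtype.ext ?_⟩
        have : ∀ (k : ℕ) (w : W),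
            (((ρ.subrepresentation W hW g - 1) ^ k) w : V) = ((ρ g - 1) ^ k) w := by
          intro k
          induction k with
          | zero => intro w; rfl
          | succ k ihk =>
            intro w
            rw [pow_succ, pow_succ, Module.End.mul_apply, Module.End.mul_apply, ihk]
            rfl
        rw [this, hm]
        rfl) rfl
    exact ⟨v, fun h => hv (Subtype.ext h), fun g => congrArg Subtype.val (hfix g)⟩

/-- Commuting operators over an algebraically closed field have a common eigenvector. -/
theorem exists_common_eigenvector_of_commute [IsAlgClosed K] [FiniteDimensional K V]
    [Nontrivial V] (ρ : Representation K G V) (hρ : ∀ g h, Commute (ρ g) (ρ h)) :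
    ∃ v : V, v ≠ 0 ∧ ∀ g, ∃ c : K, ρ g v = c • v := by
  induction hd : Module.finrank K V using Nat.strong_induction_on generalizing V with
  | _ d ih =>
  by_cases scalar : ∀ g, ∃ c : K, ∀ v, ρ g v = c • v
  · obtain ⟨v, hv⟩ := exists_ne (0 : V)
    exact ⟨v, hv, fun g => (scalar g).imp fun c hc => hc v⟩
  · push Not at scalar
    obtain ⟨g, hg⟩ := scalar
    obtain ⟨c, hc⟩ := Module.End.exists_eigenvalue (ρ g)
    -- An eigenspace of a non-scalar operator is proper, and everything commuting with that operator
    -- preserves it.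
    let W := Module.End.eigenspace (ρ g) c
    have hW : ∀ h, W ≤ W.comap (ρ h) := fun h w hw => by
      have hw' := Module.End.mem_eigenspace_iff.1 hw
      refine Module.End.mem_eigenspace_iff.2 ?_
      rw [← Module.End.mul_apply, (hρ g h).eq, Module.End.mul_apply, hw', map_smul]
    have : Nontrivial W := Submodule.nontrivial_iff_ne_bot.2 hc
    have htop : W ≠ ⊤ := fun h => by
      obtain ⟨v, hv⟩ := hg c
      exact hv (Module.End.mem_eigenspace_iff.1 (h ▸ Submodule.mem_top : v ∈ W))
    obtain ⟨v, hv, hfix⟩ := ih _ (hd ▸ Submodule.finrank_lt htop) (ρ.subrepresentation W hW)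
      (fun a b => LinearMap.ext fun w => Subtype.ext (DFunLike.congr_fun (hρ a b).eq (w : V))) rfl
    exact ⟨v, fun h => hv (Subtype.ext h), fun g => (hfix g).imp fun c hc => congrArg Subtype.val hc⟩

/-- If a normal subgroup acts by unipotent operators and the quotient by it is abelian, then there
is a common eigenvector. -/
theorem exists_common_eigenvector_of_normal [IsAlgClosed K] [FiniteDimensional K V]
    [Nontrivial V] (ρ : Representation K G V) (U : Subgroup G) [U.Normal]
    (hU : ∀ u ∈ U, IsNilpotent (ρ u - 1)) (hab : ∀ a b : G ⧸ U, a * b = b * a) :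
    ∃ v : V, v ≠ 0 ∧ ∀ g, ∃ c : K, ρ g v = c • v := by
  let W : Submodule K V := invariants (ρ.comp U.subtype)
  have mem_W : ∀ v, v ∈ W ↔ ∀ u ∈ U, ρ u v = v := fun v =>
    ⟨fun h u hu => h ⟨u, hu⟩, fun h u => h u u.2⟩
  have hW : ∀ h, W ≤ W.comap (ρ h) := fun h w hw => by
    refine (mem_W _).2 fun u hu => ?_
    have h1 := (mem_W w).1 hw (h⁻¹ * u * h) (by
      simpa using ‹U.Normal›.conj_mem u hu h⁻¹)
    rw [← Module.End.mul_apply, ← map_mul]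
    rw [show u * h = h * (h⁻¹ * u * h) by group, map_mul, Module.End.mul_apply, h1]
  obtain ⟨v, hv, hfix⟩ := exists_fixed_of_isNilpotent (ρ.comp U.subtype) fun u => hU u u.2
  have : Nontrivial W :=
    Submodule.nontrivial_iff_ne_bot.2 ((Submodule.ne_bot_iff _).2 ⟨v, hfix, hv⟩)
  obtain ⟨w, hw, heig⟩ := exists_common_eigenvector_of_commute (ρ.subrepresentation W hW)
    (fun a b => LinearMap.ext fun w => Subtype.ext (by
      -- `a * b` and `b * a` differ on the right by an element of `U`, which fixes `w`.
      have h1 : (b * a)⁻¹ * (a * b) ∈ U := QuotientGroup.eq.1 (hab b a)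
      have h2 := (mem_W w).1 w.2 _ h1
      change (ρ a * ρ b) (w : V) = (ρ b * ρ a) (w : V)
      rw [← map_mul, ← map_mul]
      conv_rhs => rw [← h2]
      rw [← Module.End.mul_apply, ← map_mul, mul_inv_cancel_left]))
  exact ⟨w, fun h => hw (Subtype.ext h), fun g => (heig g).imp fun c hc => congrArg Subtype.val hc⟩

end Representation

namespace LinearAlgebraicGroup

open Module

/-! ### Regular characters and rational representations -/

section Rational

variable {K : Type*} [Field K] {H : Type*} [Group H] [LinearAlgebraicGroup K H]

/-- A representation is rational if its matrix coefficients are regular functions. -/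
def IsRational {V : Type*} [AddCommGroup V] [Module K V] (ρ : Representation K H V) : Prop :=
  ∀ (l : Dual K V) (v : V), (fun h => l (ρ h v)) ∈ regularFunctions (K := K) (H := H)

variable (K H) in
/-- The intersection of the kernels of all regular characters of `H`. -/
def characterKernel : Subgroup H :=
  ⨅ χ : {χ : H →* Kˣ // (fun h => (χ h : K)) ∈ regularFunctions (K := K) (H := H)}, χ.1.ker

theorem mem_characterKernel {u : H} : u ∈ characterKernel K H ↔
    ∀ χ : H →* Kˣ, (fun h => (χ h : K)) ∈ regularFunctions (K := K) (H := H) → χ u = 1 := by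
  simp [characterKernel, Subgroup.mem_iInf]

instance : (characterKernel K H).Normal where
  conj_mem u hu g := mem_characterKernel.2 fun χ hχ => by
    simp [mem_characterKernel.1 hu χ hχ]

theorem isZariskiClosed_characterKernel : IsZariskiClosed K (characterKernel K H : Set H) := by
  refine ⟨{f | f ∈ regularFunctions (K := K) (H := H) ∧ ∃ χ : H →* Kˣ,
    (fun h => (χ h : K)) ∈ regularFunctions (K := K) (H := H) ∧ f = fun h => (χ h : K) - 1},
    fun f hf => hf.1, Set.ext fun u => ?_⟩
  rw [SetLike.mem_coe, mem_characterKernel]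
  constructor
  · rintro hu f ⟨-, χ, hχ, rfl⟩
    simp [hu χ hχ]
  · intro hu χ hχ
    have := hu (fun h => (χ h : K) - 1) ⟨Subalgebra.sub_mem _ hχ (Subalgebra.one_mem _), χ, hχ, rfl⟩
    exact Units.ext (sub_eq_zero.1 this)

/-- Characters take values in the commutative group `Kˣ`, so they all kill commutators. -/
theorem quotient_characterKernel_mul_comm (a b : H ⧸ characterKernel K H) : a * b = b * a := by
  induction a using QuotientGroup.induction_on with | _ a =>
  induction b using QuotientGroup.induction_on with | _ b =>
  refine QuotientGroup.eq.2 (mem_characterKernel.2 fun χ _ => ?_)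
  rw [map_mul, map_inv, map_mul, map_mul, mul_comm (χ b), inv_mul_cancel]

variable {V : Type*} [AddCommGroup V] [Module K V]

/-- If every algebraic homomorphism to a general linear group has an eigenvector, so does every
finite-dimensional rational representation. -/
theorem IsRational.exists_eigenvector
    (hH : ∀ (n : ℕ), 0 < n → ∀ ρ : H →* GL (Fin n) K, IsAlgebraicHom K ρ →
      ∃ v : Fin n → K, IsEigenvector ρ v)
    [FiniteDimensional K V] [Nontrivial V] {ρ : Representation K H V} (hρ : IsRational ρ) :
    ∃ v : V, v ≠ 0 ∧ ∀ g, ∃ c : K, ρ g v = c • v := by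
  let b := finBasis K V
  let M : H →* Matrix (Fin (finrank K V)) (Fin (finrank K V)) K :=
    (LinearMap.toMatrixAlgEquiv b : End K V →* Matrix _ _ K).comp ρ
  let σ : H →* GL (Fin (finrank K V)) K := M.toHomUnits
  have entry : ∀ i j, (fun h => M h i j) ∈ regularFunctions (K := K) (H := H) := fun i j => by
    have := hρ (b.coord i) (b j)
    simpa [M, LinearMap.toMatrixAlgEquiv_apply] using! this
  have hdet : (fun h => (M h).det) ∈ regularFunctions (K := K) (H := H) := by
    simp only [Matrix.det_apply, Units.smul_def]
    have : (fun h => ∑ τ : Equiv.Perm (Fin (finrank K V)),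
        (Equiv.Perm.sign τ : ℤ) • ∏ i, M h (τ i) i) =
        ∑ τ : Equiv.Perm (Fin (finrank K V)),
        (Equiv.Perm.sign τ : ℤ) • ∏ i, fun h => M h (τ i) i := by
      ext h
      simp
    rw [this]
    exact Subalgebra.sum_mem _ fun τ _ =>
      Subalgebra.zsmul_mem _ (Subalgebra.prod_mem _ fun i _ => entry _ _) _
  have hσ : IsAlgebraicHom K σ := fun f hf => by
    change f ∈ glRegular K _ at hf
    induction hf using Algebra.adjoin_induction with
    | mem f hf =>
      rcases hf with ⟨i, j, rfl⟩ | rfl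
      · exact entry i j
      -- The inverse determinant pulls back to `h ↦ det M(h⁻¹)`, which is regular because inversion
      -- is.
      · convert regular_inv _ hdet using 1
        funext h
        change (M h).det⁻¹ = (M h⁻¹).det
        refine inv_eq_of_mul_eq_one_right ?_
        rw [← Matrix.det_mul, ← map_mul, mul_inv_cancel, map_one, Matrix.det_one]
    | algebraMap r => exact Subalgebra.algebraMap_mem _ r
    | add f f' _ _ h h' => exact Subalgebra.add_mem _ h h'
    | mul f f' _ _ h h' => exact Subalgebra.mul_mem _ h h'
  obtain ⟨v, hv, heig⟩ := hH _ finrank_pos σ hσ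
  refine ⟨b.equivFun.symm v, (LinearEquiv.map_ne_zero_iff _).2 hv, fun g => (heig g).imp fun c hc => ?_⟩
  apply b.equivFun.injective
  rw [map_smul, LinearEquiv.apply_symm_apply, ← hc]
  change _ = (LinearMap.toMatrix b b (ρ g)).mulVec v
  have := LinearMap.toMatrix_mulVec_repr b b (ρ g) (b.equivFun.symm v)
  rw [← b.equivFun_apply, ← b.equivFun_apply, LinearEquiv.apply_symm_apply] at this
  exact this.symm

/-- If every algebraic homomorphism to a general linear group has an eigenvector, then the common
kernel of the characters acts unipotently on rational representations. -/
theorem IsRational.isNilpotent_sub_one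
    (hH : ∀ (n : ℕ), 0 < n → ∀ ρ : H →* GL (Fin n) K, IsAlgebraicHom K ρ →
      ∃ v : Fin n → K, IsEigenvector ρ v)
    [FiniteDimensional K V] {ρ : Representation K H V} (hρ : IsRational ρ)
    {u : H} (hu : u ∈ characterKernel K H) : IsNilpotent (ρ u - 1) := by
  induction hd : finrank K V using Nat.strong_induction_on generalizing V with
  | _ d ih =>
  rcases subsingleton_or_nontrivial V with hV | hV
  · exact ⟨1, Subsingleton.elim _ _⟩
  obtain ⟨v, hv, heig⟩ := hρ.exists_eigenvector hH
  choose c hc using heig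
  let χ : H →* K :=
    { toFun := c
      map_one' := smul_left_injective K hv (by simp [← hc])
      map_mul' := fun g h => smul_left_injective K hv (by
        change c (g * h) • v = (c g * c h) • v
        rw [← hc, map_mul, Module.End.mul_apply, hc, map_smul, hc, smul_smul, mul_comm]) }
  -- With `l v = 1`, the eigencharacter is the matrix coefficient `h ↦ l (ρ h v)`, hence regular.
  obtain ⟨l, hl⟩ := Projective.exists_dual_eq_one K hv
  have hcu : c u = 1 := by
    refine congrArg Units.val (mem_characterKernel.1 hu χ.toHomUnits ?_)
    convert hρ l v using 1
    funext h
    rw [hc, map_smul, hl, smul_eq_mul, mul_one]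
    rfl
  let W : Submodule K V := K ∙ v
  have hW : ∀ g, W ≤ W.comap (ρ g) := fun g => by
    refine (Submodule.span_singleton_le_iff_mem _ _).2 ?_
    exact Submodule.mem_comap.2 (hc g ▸ Submodule.smul_mem _ _ (Submodule.mem_span_singleton_self v))
  have hrat : IsRational (ρ.quotient W hW) := fun l x => by
    obtain ⟨x, rfl⟩ := W.mkQ_surjective x
    exact hρ (l ∘ₗ W.mkQ) x
  have hlt : finrank K (V ⧸ W) < d := by
    have h1 := W.finrank_quotient_add_finrank
    have h2 : finrank K W = 1 := finrank_span_singleton hv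
    omega
  obtain ⟨m, hm⟩ := ih _ hlt hrat rfl
  have hpow : ∀ (k : ℕ) (x : V),
      W.mkQ (((ρ u - 1) ^ k) x) = ((ρ.quotient W hW u - 1) ^ k) (W.mkQ x) := by
    intro k
    induction k with
    | zero => intro x; rfl
    | succ k ihk =>
      intro x
      rw [pow_succ, pow_succ, Module.End.mul_apply, Module.End.mul_apply, ihk]
      rfl
  -- The first `m` factors push `V` into the line `W`; one more kills it, since `u` fixes `v`.
  refine ⟨m + 1, LinearMap.ext fun x => ?_⟩
  have hx : ((ρ u - 1) ^ m) x ∈ W := by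
    rw [← Submodule.Quotient.mk_eq_zero, ← Submodule.mkQ_apply, hpow, hm]
    rfl
  obtain ⟨a, ha⟩ := Submodule.mem_span_singleton.1 hx
  rw [pow_succ', Module.End.mul_apply, ← ha, map_smul, LinearMap.sub_apply, hc, hcu]
  simp

end Rational

/-! ### Local finiteness of right translation, and unipotent elements -/

section RegularRepresentation

variable (K : Type*) [Field K] (H : Type*) [Group H]

/-- The representation of `H` by right translations on functions on `H`. -/
def rightRegular : Representation K H (H → K) where
  toFun := rightTranslation K
  map_one' := LinearMap.ext fun f => funext fun x => by simp [rightTranslation, LinearMap.funLeft]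
  map_mul' g h := LinearMap.ext fun f => funext fun x => by
    simp [rightTranslation, LinearMap.funLeft, mul_assoc]

variable {K H} [LinearAlgebraicGroup K H]

/-- Every regular function lies in a finite-dimensional rational subrepresentation of the right
regular representation. -/
theorem exists_finiteDimensional_rational {f : H → K}
    (hf : f ∈ regularFunctions (K := K) (H := H)) :
    ∃ (W : Submodule K (H → K)) (hW : ∀ h, W ≤ W.comap (rightRegular K H h)),
      f ∈ W ∧ FiniteDimensional K W ∧ IsRational ((rightRegular K H).subrepresentation W hW) := by
  let W : Submodule K (H → K) := Submodule.span K (Set.range fun h => rightRegular K H h f)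
  have hW : ∀ h, W ≤ W.comap (rightRegular K H h) := fun h => by
    refine Submodule.span_le.2 ?_
    rintro _ ⟨g, rfl⟩
    refine Submodule.subset_span ⟨h * g, ?_⟩
    exact DFunLike.congr_fun (map_mul (rightRegular K H) h g) f
  -- Writing `g (x * h) = ∑ a i x * b i h` puts all translates of `g` in the span of finitely many
  -- `a i`, with coefficients regular in `h`.
  have expand : ∀ g ∈ regularFunctions (K := K) (H := H), ∃ (m : ℕ) (a b : Fin m → H → K),
      (∀ i, b i ∈ regularFunctions (K := K) (H := H)) ∧
        ∀ h, rightRegular K H h g = ∑ i, b i h • a i := fun g hg => by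
    obtain ⟨m, a, b, -, hb, hab⟩ := regular_mul g hg
    refine ⟨m, a, b, hb, fun h => funext fun x => ?_⟩
    simpa [mul_comm] using! hab x h
  have hreg : ∀ g ∈ W, g ∈ regularFunctions (K := K) (H := H) := by
    suffices W ≤ Subalgebra.toSubmodule (regularFunctions (K := K) (H := H)) from this
    refine Submodule.span_le.2 ?_
    rintro _ ⟨h, rfl⟩
    obtain ⟨m, a, b, ha, -, hab⟩ := regular_mul f hf
    have : rightRegular K H h f = ∑ i, b i h • a i := funext fun x => by
      simpa [mul_comm] using! hab x h
    change rightRegular K H h f ∈ regularFunctions (K := K) (H := H)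
    rw [this]
    exact Subalgebra.sum_mem _ fun i _ => Subalgebra.smul_mem _ (ha i) _
  refine ⟨W, hW, Submodule.subset_span ⟨1, by simp⟩, ?_, fun l g => ?_⟩
  · obtain ⟨m, a, b, -, hab⟩ := expand f hf
    have : FiniteDimensional K (Submodule.span K (Set.range a)) :=
      FiniteDimensional.span_of_finite K (Set.finite_range a)
    refine Submodule.finiteDimensional_of_le (S₂ := Submodule.span K (Set.range a)) ?_
    refine Submodule.span_le.2 ?_
    rintro _ ⟨h, rfl⟩
    change rightRegular K H h f ∈ Submodule.span K (Set.range a)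
    rw [hab]
    exact Submodule.sum_mem _ fun i _ => Submodule.smul_mem _ _ (Submodule.subset_span ⟨i, rfl⟩)
  · obtain ⟨m, a, b, hb, hab⟩ := expand g (hreg g g.2)
    -- The `a i` need not lie in `W`, so `l` is extended to all functions before being applied to
    -- them.
    obtain ⟨l', hl'⟩ := l.exists_extend
    have : (fun h => l ((rightRegular K H).subrepresentation W hW h g)) =
        ∑ i, l' (a i) • b i := by
      funext h
      have h1 : l ((rightRegular K H).subrepresentation W hW h g) =
          l' (rightRegular K H h g) := by
        rw [← hl']
        rfl
      rw [h1, hab]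
      simp [mul_comm]
    rw [this]
    exact Subalgebra.sum_mem _ fun i _ => Subalgebra.smul_mem _ (hb i) _

/-- If every algebraic homomorphism to a general linear group has an eigenvector, then the common
kernel of the characters is unipotent. -/
theorem isUnipotentSubgroup_characterKernel
    (hH : ∀ (n : ℕ), 0 < n → ∀ ρ : H →* GL (Fin n) K, IsAlgebraicHom K ρ →
      ∃ v : Fin n → K, IsEigenvector ρ v) :
    IsUnipotentSubgroup K (characterKernel K H) := by
  intro u hu f hf
  obtain ⟨W, hW, hfW, _, hrat⟩ := exists_finiteDimensional_rational hf
  obtain ⟨m, hm⟩ := hrat.isNilpotent_sub_one hH hu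
  have hpow : ∀ (k : ℕ) (w : W), ((((rightRegular K H).subrepresentation W hW u - 1) ^ k) w :
      H → K) = ((rightTranslation K u - 1) ^ k) w := by
    intro k
    induction k with
    | zero => intro w; rfl
    | succ k ihk =>
      intro w
      rw [pow_succ, pow_succ, Module.End.mul_apply, Module.End.mul_apply, ihk]
      rfl
  refine ⟨m, ?_⟩
  rw [← hpow m ⟨f, hfW⟩, hm]
  rfl

/-- An algebraic homomorphism to a general linear group maps unipotent elements to unipotent
matrices. -/
theorem IsUnipotentElement.isNilpotent_sub_one {n : ℕ} {ρ : H →* GL (Fin n) K}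
    (hρ : IsAlgebraicHom K ρ) {u : H} (hu : IsUnipotentElement K u) :
    IsNilpotent ((ρ u : Matrix (Fin n) (Fin n) K) - 1) := by
  -- On matrix entries, translation minus the identity becomes right multiplication by `ρ u - 1`;
  -- evaluating at `x = 1` recovers the powers of `ρ u - 1`.
  have hpow : ∀ (i j : Fin n) (k : ℕ) (x : H),
      ((rightTranslation K u - 1) ^ k) (fun h => (ρ h : Matrix (Fin n) (Fin n) K) i j) x =
        ((ρ x : Matrix (Fin n) (Fin n) K) * ((ρ u : Matrix (Fin n) (Fin n) K) - 1) ^ k) i j := by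
    intro i j k
    induction k with
    | zero => intro x; simp
    | succ k ihk =>
      intro x
      have h1 : ∀ F : H → K, (rightTranslation K u - 1) F x = F (x * u) - F x := fun F => rfl
      rw [pow_succ', Module.End.mul_apply, h1, ihk, ihk, pow_succ', ← mul_assoc, mul_sub, mul_one,
        sub_mul, Matrix.sub_apply, map_mul, Units.val_mul]
  choose m hm using fun i j => hu _ (hρ _ (entry_mem_glRegular i j))
  -- The sum of the exponents bounds each `m i j`, so it serves all entries at once.
  have hzero : ∀ i j, (((ρ u : Matrix (Fin n) (Fin n) K) - 1) ^ ∑ p : Fin n × Fin n, m p.1 p.2) i j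
      = 0 := fun i j => by
    have hle : m i j ≤ ∑ p : Fin n × Fin n, m p.1 p.2 :=
      Finset.single_le_sum (f := fun p : Fin n × Fin n => m p.1 p.2) (fun _ _ => Nat.zero_le _)
        (Finset.mem_univ (i, j))
    have h1 := hpow i j (∑ p : Fin n × Fin n, m p.1 p.2) 1
    rw [map_one, Units.val_one, one_mul] at h1
    rw [← h1, ← Nat.sub_add_cancel hle, pow_add, Module.End.mul_apply]
    have h2 : ((rightTranslation K u - 1) ^ m i j)
      (fun h => (ρ h : Matrix (Fin n) (Fin n) K) i j) = 0 := hm i j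
    rw [h2, map_zero]
    rfl
  exact ⟨_, Matrix.ext hzero⟩

end RegularRepresentation

end LinearAlgebraicGroup

/-! ### The equivalence -/

theorem mainTheorem4 (K : Type*) [Field K] [IsAlgClosed K]
    (H : Type*) [Group H] [LinearAlgebraicGroup K H] :
    (∀ (n : ℕ), 0 < n → ∀ ρ : H →* GL (Fin n) K, LinearAlgebraicGroup.IsAlgebraicHom K ρ →
      ∃ v : Fin n → K, LinearAlgebraicGroup.IsEigenvector ρ v) ↔
    (∃ (U : Subgroup H) (_ : U.Normal),
      LinearAlgebraicGroup.IsZariskiClosed K (U : Set H) ∧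
      LinearAlgebraicGroup.IsUnipotentSubgroup K U ∧
      ∀ a b : H ⧸ U, a * b = b * a) := by
  constructor
  · intro hH
    exact ⟨LinearAlgebraicGroup.characterKernel K H, inferInstance,
      LinearAlgebraicGroup.isZariskiClosed_characterKernel,
      LinearAlgebraicGroup.isUnipotentSubgroup_characterKernel hH,
      LinearAlgebraicGroup.quotient_characterKernel_mul_comm⟩
  · rintro ⟨U, _, -, hU, hab⟩ n hn ρ hρ
    have : Nonempty (Fin n) := ⟨⟨0, hn⟩⟩
    let σ : Representation K H (Fin n → K) :=
      ((Matrix.toLinAlgEquiv' : Matrix (Fin n) (Fin n) K ≃ₐ[K] _) :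
        Matrix (Fin n) (Fin n) K →* Module.End K (Fin n → K)).comp ((Units.coeHom _).comp ρ)
    refine σ.exists_common_eigenvector_of_normal U (fun u hu => ?_) hab
    have := ((hU u hu).isNilpotent_sub_one hρ).map
      (Matrix.toLinAlgEquiv' : Matrix (Fin n) (Fin n) K ≃ₐ[K] _)
    rwa [map_sub, map_one] at this
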